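/- Let $n\ge 1$ be an integer. Write $\binom{\alpha}{p}=\alpha(\alpha-1)\cdots(\alpha-p+1)/p!$ for integers $p\ge 0$, and $(\alpha)_p=\alpha(\alpha+1)\cdots(\alpha+p-1)$, $(\alpha)_0=1$. (a) In the polynomial ring $\mathbb{Q}[x]$ in an indeterminate $x$, $$\det_{0\le i,j\le n-1}\left(4^i\binom{x+i+2j+1}{2j+1}+\binom{x-i+2j+1}{2j+1}\right)=2^{\binom{n+1}{2}+1}\,3^{\binom n2}\prod_{i=1}^n\frac{i!}{(2i)!}\prod_{i=0}^{n-1}(x+3i+1)_{n-i}.$$ (b) For every complex number $x$ such that none of the numbers $\frac{3i+x}{2}$, $1\le i\le n$, is a non-positive integer, $$\det_{0\le i,j\le n-1}\left(4^i\binom{x+i+2j+1}{2j+1}+\binom{x-i+2j+1}{2j+1}\right)=2\prod_{i=1}^n\frac{2^{2i-1}\,3^{i-1}\,\Gamma(i)\,\Gamma\!\left(\frac{3i+x}{2}\right)}{\Gamma(2i)\,\Gamma\!\left(\frac{i+x}{2}\right)}=2^{\binom{n+1}{2}+1}\,3^{\binom n2}\prod_{i=1}^n\frac{i!}{(2i)!}\prod_{i=0}^{n-1}(x+3i+1)_{n-i},$$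 where $1/\Gamma(z)$ is read as $0$ when $z$ is a non-positive integer. -/

import Mathlib

/-- The `n × n` matrix with entries
`4 ^ i * binom (x + i + 2 j + 1) (2 j + 1) + binom (x - i + 2 j + 1) (2 j + 1)`, for `0 ≤ i, j ≤ n - 1`.
The generalised binomial coefficient `α (α - 1) ⋯ (α - p + 1) / p!` is `Ring.choose α p`. -/
noncomputable def binomMatrix {R : Type*} [CommRing R] [BinomialRing R] (n : ℕ) (x : R) :
    Matrix (Fin n) (Fin n) R :=
  Matrix.of fun i j =>
    4 ^ (i : ℕ) * Ring.choose (x + ((i : ℕ) : R) + 2 * ((j : ℕ) : R) + 1) (2 * (j : ℕ) + 1)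
      + Ring.choose (x - ((i : ℕ) : R) + 2 * ((j : ℕ) : R) + 1) (2 * (j : ℕ) + 1)

/-- The Pochhammer symbol `(a)_p = a (a + 1) ⋯ (a + p - 1)`. -/
noncomputable def pochhammer {R : Type*} [CommRing R] (a : R) (p : ℕ) : R :=
  (ascPochhammer R p).eval a

/-! Let `T` be the shift `X ↦ X + 1`, `E = 4T + T⁻¹`, `∇ = 1 - T⁻¹` and `b_j = binom (X + 2j + 1)
(2j + 1)`. As `4T · T⁻¹ = 4`, the `(i, j)` entry is `D_i(E) b_j` with `D_i` the Dickson polynomial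
of parameter 4. Since `D_0 = 2` and the other `D_i` are monic of degree `i`, the determinant is `2
det (q_i(E) b_j)` for any monic `q_i` of degree `i`; `q` may be chosen to suit each purpose. Zeros:
`E - 2 = T(∇² + 3)` and `E - 4 = T³(1 - ∇²)²`, while `∇²` preserves the span of the `b_j`, which all
vanish at `-1`. Hence `q_d = (X - 2)^(d-i) (X - 4)^i` gives a row vanishing at `-(d + 2i + 1)`
(`X_add_C_dvd_aeval_shiftSum`). Collecting these over `i ≤ d < n` yields `n(n+1)/2` linear factors.
Degree and leading coefficient: `E - 5` lowers degrees, so `q_i = (X - 5)^i` bounds the degree by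
`n(n+1)/2` and reduces the top coefficient to a Vandermonde determinant (`shiftSumDet_degree`). The
two together determine the polynomial. -/

/-! ### Shift operators and rising binomials -/

section ShiftOperator

open Polynomial

/-- The operator `f(X) ↦ 4 f(X + 1) + f(X - 1)`. -/
noncomputable def shiftSum : Module.End ℚ ℚ[X] := 4 * taylor 1 + taylor (-1)

/-- The backward difference `f(X) ↦ f(X) - f(X - 1)`. -/
noncomputable def backwardDiff : Module.End ℚ ℚ[X] := 1 - taylor (-1)

/-- The polynomial `binom (X + k) k`. -/
noncomputable def risingBinom (k : ℕ) : ℚ[X] := Ring.choose (X + (k : ℚ[X])) k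

theorem taylor_choose (c : ℚ) (p : ℚ[X]) (k : ℕ) :
    taylor c (Ring.choose p k) = Ring.choose (taylor c p) k :=
  Ring.map_choose (taylorAlgHom c) p k

theorem taylor_natCast (c : ℚ) (k : ℕ) : taylor c (k : ℚ[X]) = k :=
  map_natCast (taylorAlgHom c) k

/-- Pascal's rule. -/
theorem backwardDiff_risingBinom_succ (k : ℕ) :
    backwardDiff (risingBinom (k + 1)) = risingBinom k := by
  have h := Ring.choose_succ_succ (X + (k : ℚ[X])) k
  simp only [backwardDiff, risingBinom, LinearMap.sub_apply, Module.End.one_apply, taylor_choose,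
    map_add, taylor_X, taylor_natCast]
  rw [show (X : ℚ[X]) + C (-1) + ((k + 1 : ℕ) : ℚ[X]) = X + (k : ℚ[X]) by
      simp only [map_neg, map_one]; push_cast; ring,
    show (X : ℚ[X]) + ((k + 1 : ℕ) : ℚ[X]) = X + (k : ℚ[X]) + 1 by push_cast; ring, h]
  ring

theorem backwardDiff_risingBinom_zero : backwardDiff (risingBinom 0) = 0 := by
  simp [backwardDiff, risingBinom]

theorem risingBinom_succ_eval_neg_one (k : ℕ) : (risingBinom (k + 1)).eval (-1) = 0 := by
  have h := Ring.map_choose (evalRingHom (-1 : ℚ)) (X + ((k + 1 : ℕ) : ℚ[X])) (k + 1)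
  rw [coe_evalRingHom] at h
  rw [risingBinom, h, eval_add, eval_X, eval_natCast,
    show (-1 : ℚ) + ((k + 1 : ℕ) : ℚ) = (k : ℚ) by push_cast; ring, Ring.choose_natCast]
  simp

theorem factorial_mul_risingBinom (k : ℕ) :
    (k.factorial : ℚ[X]) * risingBinom k = (ascPochhammer ℚ[X] k).eval (X + 1) := by
  have h := Ring.factorial_nsmul_multichoose_eq_ascPochhammer (X + 1 : ℚ[X]) k
  rw [Ring.multichoose_eq, ascPochhammer_smeval_eq_eval, nsmul_eq_mul] at h
  rw [← h, risingBinom]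
  congr 2
  ring

theorem ascPochhammer_eval_X_add_one (k : ℕ) :
    ((ascPochhammer ℚ[X] k).eval (X + 1)).natDegree ≤ k ∧
      ((ascPochhammer ℚ[X] k).eval (X + 1)).coeff k = 1 := by
  induction k with
  | zero => simp
  | succ k ih =>
    have h1 : (X + 1 + (k : ℚ[X])).natDegree ≤ 1 := by compute_degree
    rw [ascPochhammer_succ_eval]
    refine ⟨natDegree_mul_le_of_le ih.1 h1, ?_⟩
    rw [coeff_mul_add_eq_of_natDegree_le ih.1 h1, ih.2]
    simp [coeff_one, coeff_natCast_ite]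

theorem risingBinom_eq (k : ℕ) :
    risingBinom k = C ((k.factorial : ℚ)⁻¹) * (ascPochhammer ℚ[X] k).eval (X + 1) := by
  rw [← factorial_mul_risingBinom, ← mul_assoc, ← C_eq_natCast, ← C_mul,
    inv_mul_cancel₀ (Nat.cast_ne_zero.2 k.factorial_ne_zero), C_1, one_mul]

theorem natDegree_risingBinom_le (k : ℕ) : (risingBinom k).natDegree ≤ k := by
  rw [risingBinom_eq]
  exact (natDegree_C_mul_le _ _).trans (ascPochhammer_eval_X_add_one k).1

theorem coeff_risingBinom_self (k : ℕ) : (risingBinom k).coeff k = (k.factorial : ℚ)⁻¹ := by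
  rw [risingBinom_eq, coeff_C_mul, (ascPochhammer_eval_X_add_one k).2, mul_one]

theorem taylor_one_mul_taylor_neg_one :
    (taylor 1 : Module.End ℚ ℚ[X]) * taylor (-1) = 1 := by
  refine LinearMap.ext fun f => ?_
  simp [taylor_taylor]

theorem taylor_neg_one_mul_taylor_one :
    (taylor (-1) : Module.End ℚ ℚ[X]) * taylor 1 = 1 := by
  refine LinearMap.ext fun f => ?_
  simp [taylor_taylor]

theorem commute_taylor_one_backwardDiff :
    Commute (taylor 1 : Module.End ℚ ℚ[X]) backwardDiff := by
  rw [Commute, SemiconjBy, backwardDiff, mul_sub, sub_mul, taylor_one_mul_taylor_neg_one,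
    taylor_neg_one_mul_taylor_one, mul_one, one_mul]

theorem taylor_one_pow_apply (m : ℕ) (f : ℚ[X]) :
    ((taylor 1 : Module.End ℚ ℚ[X]) ^ m) f = taylor (m : ℚ) f := by
  induction m with
  | zero => simp
  | succ m ih => rw [pow_succ', Module.End.mul_apply, ih, taylor_taylor]; push_cast; ring_nf

theorem shiftSum_sub_two :
    shiftSum - 2 = (taylor 1 : Module.End ℚ ℚ[X]) * (backwardDiff ^ 2 + 3) := by
  have h1 := taylor_one_mul_taylor_neg_one
  have h2 : backwardDiff ^ 2 + 3 = 4 - 2 * taylor (-1) + taylor (-1) * taylor (-1) := by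
    simpa only [backwardDiff, map_add, map_sub, map_mul, map_pow, map_one, map_ofNat, aeval_X]
      using congrArg (aeval (taylor (-1) : Module.End ℚ ℚ[X]))
      (show ((1 - X) ^ 2 + 3 : ℚ[X]) = 4 - 2 * X + X * X by ring)
  rw [h2, mul_add, mul_sub, ← mul_assoc, ← mul_assoc, h1, one_mul,
    (Commute.ofNat_right (taylor 1 : Module.End ℚ ℚ[X]) 2).eq,
    (Commute.ofNat_right (taylor 1 : Module.End ℚ ℚ[X]) 4).eq, mul_assoc, h1, shiftSum, mul_one]
  exact add_sub_right_comm _ _ _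

theorem shiftSum_sub_four :
    shiftSum - 4 = (taylor 1 : Module.End ℚ ℚ[X]) * (1 + backwardDiff) ^ 2 := by
  have h1 := taylor_one_mul_taylor_neg_one
  have h2 : (1 + backwardDiff) ^ 2 = 4 - 4 * taylor (-1) + taylor (-1) * taylor (-1) := by
    simpa only [backwardDiff, map_add, map_sub, map_mul, map_pow, map_one, map_ofNat, aeval_X]
      using congrArg (aeval (taylor (-1) : Module.End ℚ ℚ[X]))
      (show ((1 + (1 - X)) ^ 2 : ℚ[X]) = 4 - 4 * X + X * X by ring)
  rw [h2, mul_add, mul_sub, ← mul_assoc, ← mul_assoc, h1, one_mul,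
    (Commute.ofNat_right (taylor 1 : Module.End ℚ ℚ[X]) 4).eq, mul_assoc, h1, shiftSum, mul_one]
  exact add_sub_right_comm _ _ _

/-- `1 - ∇ = T⁻¹`, so inserting `T² (1 - ∇)² = 1` makes the `∇`-part even, at the cost of two more
shifts. -/
theorem shiftSum_sub_four_eq_taylor_pow :
    shiftSum - 4 = (taylor 1 : Module.End ℚ ℚ[X]) ^ 3 * (1 - backwardDiff ^ 2) ^ 2 := by
  have hb : (taylor 1 : Module.End ℚ ℚ[X]) ^ 2 * (1 - backwardDiff) ^ 2 = 1 := by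
    have : (1 - backwardDiff : Module.End ℚ ℚ[X]) = taylor (-1) := by rw [backwardDiff]; abel
    rw [this, pow_two, pow_two, mul_assoc, ← mul_assoc (taylor 1) (taylor (-1)),
      taylor_one_mul_taylor_neg_one, one_mul, taylor_one_mul_taylor_neg_one]
  have hc : (1 - backwardDiff ^ 2 : Module.End ℚ ℚ[X]) ^ 2
      = (1 - backwardDiff) ^ 2 * (1 + backwardDiff) ^ 2 := by
    simpa using congrArg (aeval backwardDiff)
      (show ((1 - X ^ 2) ^ 2 : ℚ[X]) = (1 - X) ^ 2 * (1 + X) ^ 2 by ring)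
  rw [shiftSum_sub_four, hc, pow_succ' (taylor 1), mul_assoc, ← mul_assoc (taylor 1 ^ 2), hb, one_mul]

/-! ### Zeros from parity -/

/-- The span of the polynomials `binom (X + k) k` with `k` odd. -/
noncomputable def oddSpan : Submodule ℚ ℚ[X] :=
  Submodule.span ℚ (Set.range fun j : ℕ => risingBinom (2 * j + 1))

theorem risingBinom_mem_oddSpan (j : ℕ) : risingBinom (2 * j + 1) ∈ oddSpan :=
  Submodule.subset_span ⟨j, rfl⟩

theorem eval_neg_one_of_mem_oddSpan {f : ℚ[X]} (hf : f ∈ oddSpan) : f.eval (-1) = 0 := by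
  have : oddSpan ≤ LinearMap.ker (leval (-1 : ℚ)) := by
    rw [oddSpan, Submodule.span_le]
    rintro _ ⟨j, rfl⟩
    exact risingBinom_succ_eval_neg_one _
  exact this hf

theorem backwardDiff_sq_mem_oddSpan {f : ℚ[X]} (hf : f ∈ oddSpan) :
    (backwardDiff ^ 2) f ∈ oddSpan := by
  have : oddSpan ≤ oddSpan.comap (backwardDiff ^ 2) := by
    nth_rewrite 1 [oddSpan]
    rw [Submodule.span_le]
    rintro _ ⟨j, rfl⟩
    simp only [SetLike.mem_coe, Submodule.mem_comap, pow_two, Module.End.mul_apply,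
      backwardDiff_risingBinom_succ]
    cases j with
    | zero => simp [backwardDiff_risingBinom_zero]
    | succ j =>
      rw [show 2 * (j + 1) = 2 * j + 1 + 1 by ring, backwardDiff_risingBinom_succ]
      exact risingBinom_mem_oddSpan j
  exact this hf

theorem aeval_backwardDiff_sq_mem_oddSpan (p : ℚ[X]) {f : ℚ[X]} (hf : f ∈ oddSpan) :
    aeval (backwardDiff ^ 2) p f ∈ oddSpan := by
  induction p using Polynomial.induction_on with
  | C a => simpa using oddSpan.smul_mem a hf
  | add p q hp hq => simpa using oddSpan.add_mem hp hq
  | monomial m a h =>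
    rw [pow_succ' X, ← mul_assoc, mul_comm (C a) X, mul_assoc, map_mul, aeval_X,
      Module.End.mul_apply]
    exact backwardDiff_sq_mem_oddSpan h

/-- The operator is `T^(3i + k)` times a polynomial in `∇²`, so the value at `-(3i + k + 1)` is the
value at `-1` of an element of `oddSpan`. -/
theorem X_add_C_dvd_aeval_shiftSum (i k j : ℕ) :
    X + C ((3 * i + k + 1 : ℕ) : ℚ) ∣
      aeval shiftSum ((X - 2) ^ k * (X - 4) ^ i : ℚ[X]) (risingBinom (2 * j + 1)) := by
  have hc := commute_taylor_one_backwardDiff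
  have hop : aeval shiftSum ((X - 2) ^ k * (X - 4) ^ i : ℚ[X])
      = (taylor 1 : Module.End ℚ ℚ[X]) ^ (3 * i + k) *
        aeval (backwardDiff ^ 2) ((X + 3) ^ k * ((1 - X) ^ 2) ^ i : ℚ[X]) := by
    have c1 : Commute (taylor 1 : Module.End ℚ ℚ[X]) (backwardDiff ^ 2 + 3) :=
      (hc.pow_right 2).add_right (Commute.ofNat_right _ 3)
    have c2 : Commute ((taylor 1 : Module.End ℚ ℚ[X]) ^ 3) ((1 - backwardDiff ^ 2) ^ 2) :=
      (((Commute.one_right _).sub_right (hc.pow_right 2)).pow_right 2).pow_left 3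
    simp only [map_mul, map_pow, map_sub, map_add, aeval_X, map_one, map_ofNat]
    rw [shiftSum_sub_two, shiftSum_sub_four_eq_taylor_pow, c1.mul_pow, c2.mul_pow, add_comm (3 * i) k,
      pow_add, pow_mul, mul_assoc, mul_assoc, ← mul_assoc ((_ + 3) ^ k),
      ((c1.symm.pow_left k).pow_right 3 |>.pow_right i).eq, mul_assoc]
  have : X + C ((3 * i + k + 1 : ℕ) : ℚ) = X - C (-((3 * i + k + 1 : ℕ) : ℚ)) := by
    rw [C_neg, sub_neg_eq_add]
  rw [this, dvd_iff_isRoot, IsRoot.def, hop, Module.End.mul_apply, taylor_one_pow_apply,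
    taylor_eval]
  rw [show -((3 * i + k + 1 : ℕ) : ℚ) + ((3 * i + k : ℕ) : ℚ) = -1 by push_cast; ring]
  exact eval_neg_one_of_mem_oddSpan
    (aeval_backwardDiff_sq_mem_oddSpan _ (risingBinom_mem_oddSpan j))

/-! ### Degree lowering by `E - 5` -/

theorem coeff_taylor_of_natDegree_le {f : ℚ[X]} {k : ℕ} (hf : f.natDegree ≤ k + 1) (c : ℚ) :
    (taylor c f).coeff k = f.coeff k + c * (k + 1) * f.coeff (k + 1) := by
  have h : (hasseDeriv k f).natDegree < 2 :=
    lt_of_le_of_lt (natDegree_hasseDeriv_le f k) (by omega)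
  rw [taylor_coeff, eval_eq_sum_range' h, Finset.sum_range_succ, Finset.sum_range_one,
    hasseDeriv_coeff, hasseDeriv_coeff]
  simp only [zero_add, Nat.choose_self, Nat.cast_one, one_mul, pow_zero, mul_one, pow_one,
    add_comm 1 k, Nat.choose_succ_self_right]
  push_cast; ring

theorem shiftSum_sub_five_apply (f : ℚ[X]) :
    (shiftSum - 5) f = C 4 * taylor 1 f + taylor (-1) f - C 5 * f := by
  simp [shiftSum, Module.End.ofNat_apply, nsmul_eq_mul, map_ofNat C]

/-- The top terms cancel since `4 + 1 = 5`; the next ones contribute `4 - 1 = 3` times the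
derivative. -/
theorem shiftSum_sub_five_coeff {f : ℚ[X]} {k : ℕ} (hf : f.natDegree ≤ k + 1) :
    ((shiftSum - 5) f).natDegree ≤ k ∧
      ((shiftSum - 5) f).coeff k = 3 * (k + 1) * f.coeff (k + 1) := by
  rw [shiftSum_sub_five_apply]
  constructor
  · refine natDegree_le_iff_coeff_eq_zero.2 fun m hm => ?_
    have hf' : f.natDegree ≤ m + 1 := by omega
    have h0 : f.coeff (m + 1) = 0 := coeff_eq_zero_of_natDegree_lt (by omega)
    simp only [coeff_sub, coeff_add, coeff_C_mul, coeff_taylor_of_natDegree_le hf', h0]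
    ring
  · simp only [coeff_sub, coeff_add, coeff_C_mul, coeff_taylor_of_natDegree_le hf]
    ring

/-- The factor `X ^ i` restores the lost degree, so the degree bound does not depend on the row `i`.
-/
theorem X_pow_mul_shiftSum_sub_five_pow {f : ℚ[X]} {k : ℕ} (hf : f.natDegree ≤ k) (i : ℕ) :
    (X ^ i * ((shiftSum - 5) ^ i) f).natDegree ≤ k ∧
      (X ^ i * ((shiftSum - 5) ^ i) f).coeff k = 3 ^ i * (k.descFactorial i : ℚ) * f.coeff k := by
  induction i generalizing f k with
  | zero => simpa using hf
  | succ i ih =>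
    rw [pow_succ (shiftSum - 5), Module.End.mul_apply]
    cases k with
    | zero =>
      have : (shiftSum - 5) f = 0 := by
        rw [eq_C_of_natDegree_le_zero hf, shiftSum_sub_five_apply, taylor_C, taylor_C,
          ← C_mul, ← C_mul, ← C_add, ← C_sub]
        ring_nf; simp
      simp [this]
    | succ k =>
      obtain ⟨h1, h2⟩ := shiftSum_sub_five_coeff hf
      obtain ⟨h3, h4⟩ := ih h1
      rw [pow_succ', mul_assoc]
      refine ⟨(natDegree_mul_le_of_le natDegree_X_le h3).trans (by omega), ?_⟩
      rw [coeff_X_mul, h4, h2, Nat.succ_descFactorial_succ]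
      push_cast; ring

end ShiftOperator

/-! ### Evaluation of the determinant of iterates -/

section ShiftDeterminant

open Polynomial

/-- The change of rows is lower triangular, with the coefficients of the `q i` as entries. -/
theorem det_aeval_apply {n : ℕ} (E : Module.End ℚ ℚ[X]) (q b : Fin n → ℚ[X])
    (hq : ∀ i, (q i).natDegree ≤ i) :
    (Matrix.of fun i j => aeval E (q i) (b j)).det =
      C (∏ i, (q i).coeff i) * (Matrix.of fun i j : Fin n => (E ^ (i : ℕ)) (b j)).det := by
  have hmul : (Matrix.of fun i j => aeval E (q i) (b j)) =
      (Matrix.of fun i m : Fin n => C ((q i).coeff m)) *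
        Matrix.of fun i j : Fin n => (E ^ (i : ℕ)) (b j) := by
    ext1 i j
    rw [Matrix.of_apply, Matrix.mul_apply,
      aeval_eq_sum_range' (lt_of_le_of_lt (hq i) i.isLt), LinearMap.sum_apply,
      ← Fin.sum_univ_eq_sum_range (fun m => ((q i).coeff m • E ^ m) (b j))]
    simp [smul_eq_C_mul]
  rw [hmul, Matrix.det_mul, Matrix.det_of_isLowerTriangular, map_prod]
  · rfl
  · intro i m him
    have him' : (i : ℕ) < m := him
    simp [coeff_eq_zero_of_natDegree_lt ((hq i).trans_lt him')]

theorem natDegree_prod_le_sum {ι : Type*} (s : Finset ι) {f : ι → ℚ[X]} {d : ι → ℕ}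
    (h : ∀ i, (f i).natDegree ≤ d i) : (∏ i ∈ s, f i).natDegree ≤ ∑ i ∈ s, d i :=
  (natDegree_prod_le s f).trans (Finset.sum_le_sum fun i _ => h i)

theorem coeff_prod_sum {ι : Type*} (s : Finset ι) {f : ι → ℚ[X]} {d : ι → ℕ}
    (h : ∀ i, (f i).natDegree ≤ d i) :
    (∏ i ∈ s, f i).coeff (∑ i ∈ s, d i) = ∏ i ∈ s, (f i).coeff (d i) := by
  induction s using Finset.cons_induction with
  | empty => simp
  | cons a s ha ih =>
    rw [Finset.prod_cons, Finset.sum_cons, Finset.prod_cons,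
      coeff_mul_add_eq_of_natDegree_le (h a) (natDegree_prod_le_sum s h), ih]

theorem natDegree_det_le_sum {n : ℕ} {M : Matrix (Fin n) (Fin n) ℚ[X]} {d : Fin n → ℕ}
    (h : ∀ i j, (M i j).natDegree ≤ d j) : M.det.natDegree ≤ ∑ j, d j := by
  rw [Matrix.det_apply']
  refine natDegree_sum_le_of_forall_le _ _ fun σ _ => ?_
  rw [← map_intCast (C : ℚ →+* ℚ[X])]
  exact (natDegree_C_mul_le _ _).trans (natDegree_prod_le_sum _ fun i => h _ i)

theorem coeff_det_sum {n : ℕ} {M : Matrix (Fin n) (Fin n) ℚ[X]} {d : Fin n → ℕ}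
    (h : ∀ i j, (M i j).natDegree ≤ d j) :
    M.det.coeff (∑ j, d j) = (Matrix.of fun i j => (M i j).coeff (d j)).det := by
  rw [Matrix.det_apply', Matrix.det_apply', finsetSum_coeff]
  refine Finset.sum_congr rfl fun σ _ => ?_
  rw [← map_intCast (C : ℚ →+* ℚ[X]), coeff_C_mul, coeff_prod_sum _ fun i => h _ i]
  rfl

theorem det_vandermonde_odd (n : ℕ) :
    (Matrix.vandermonde fun i : Fin n => (2 * (i : ℕ) + 1 : ℚ)).det =
      2 ^ n.choose 2 * ∏ i ∈ Finset.range n, (i.factorial : ℚ) := by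
  have h : (Matrix.vandermonde fun i : Fin n => (2 * (i : ℕ) : ℚ)) =
      Matrix.of fun i j : Fin n => (2 : ℚ) ^ (j : ℕ) *
        Matrix.vandermonde (fun i : Fin n => ((i : ℕ) : ℚ)) i j := by
    ext i j
    simp [Matrix.vandermonde_apply, mul_pow]
  rw [Matrix.det_vandermonde_add, h, Matrix.det_mul_row, Finset.prod_pow_eq_pow_sum,
    Fin.sum_univ_eq_sum_range (fun i => i), Finset.sum_range_id, ← Nat.choose_two_right]
  congr 1
  cases n with
  | zero => simp
  | succ n =>
    rw [Matrix.det_vandermonde_id_eq_superFactorial, ← Nat.prod_range_succ_factorial,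
      Nat.cast_prod]

theorem det_descFactorial_odd (n : ℕ) :
    (Matrix.of fun i j : Fin n => ((2 * (j : ℕ) + 1).descFactorial i : ℚ)).det =
      2 ^ n.choose 2 * ∏ i ∈ Finset.range n, (i.factorial : ℚ) := by
  rw [← det_vandermonde_odd, Matrix.det_eval_matrixOfPolynomials_eq_det_vandermonde _
    (fun i : Fin n => descPochhammer ℚ i) (fun i => descPochhammer_natDegree ℚ i)
    fun i => monic_descPochhammer ℚ i, ← Matrix.det_transpose]
  congr 1
  ext i j
  simp only [Matrix.transpose_apply, Matrix.of_apply]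
  rw [← descPochhammer_eval_eq_descFactorial]
  push_cast
  rfl

/-- The determinant of the iterates of `shiftSum` on the polynomials `binom (X + 2 j + 1) (2 j + 1)`. -/
noncomputable def shiftSumDet (n : ℕ) : ℚ[X] :=
  (Matrix.of fun i j : Fin n => (shiftSum ^ (i : ℕ)) (risingBinom (2 * j + 1))).det

theorem det_aeval_shiftSum_of_monic {n : ℕ} {q : Fin n → ℚ[X]} (hm : ∀ i, (q i).Monic)
    (hq : ∀ i, (q i).natDegree = i) :
    (Matrix.of fun i j : Fin n => aeval shiftSum (q i) (risingBinom (2 * j + 1))).det =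
      shiftSumDet n := by
  rw [det_aeval_apply shiftSum q (fun j => risingBinom (2 * j + 1)) fun i => (hq i).le,
    Finset.prod_eq_one, C_1, one_mul, shiftSumDet]
  intro i _
  rw [← hq i]
  exact hm i

theorem sum_range_odd (n : ℕ) : ∑ j ∈ Finset.range n, (2 * j + 1) = n.choose 2 + (n + 1).choose 2 := by
  induction n with
  | zero => rfl
  | succ n ih =>
    rw [Finset.sum_range_succ, ih, Nat.choose_succ_succ' (n + 1) 1, Nat.choose_one_right,
      Nat.choose_succ_succ' n 1, Nat.choose_one_right]
    ring

theorem shiftSumDet_degree (n : ℕ) :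
    (shiftSumDet n).natDegree ≤ (n + 1).choose 2 ∧
      (shiftSumDet n).coeff ((n + 1).choose 2) =
        6 ^ n.choose 2 * ∏ i ∈ Finset.range n, (i.factorial : ℚ) / ((2 * i + 1).factorial : ℚ) := by
  -- Column `j` has degree at most `2j + 1`, and the row factors contribute exactly `X ^ n.choose
  -- 2`, which is cancelled below.
  set M : Matrix (Fin n) (Fin n) ℚ[X] := Matrix.of fun i j =>
    X ^ (i : ℕ) * ((shiftSum - 5) ^ (i : ℕ)) (risingBinom (2 * j + 1)) with hM
  have hent (i j : Fin n) := X_pow_mul_shiftSum_sub_five_pow (natDegree_risingBinom_le (2 * j + 1)) i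
  have hdet : M.det = X ^ n.choose 2 * shiftSumDet n := by
    have h5 : (aeval shiftSum (X - C 5 : ℚ[X])) = shiftSum - 5 := by
      rw [map_sub, aeval_X, map_ofNat, map_ofNat]
    rw [← det_aeval_shiftSum_of_monic (q := fun i => (X - C 5) ^ (i : ℕ))
      (fun i => (monic_X_sub_C 5).pow _) (fun i => by simp [natDegree_pow]),
      show M.det = _ from Matrix.det_mul_column (fun i : Fin n => (X : ℚ[X]) ^ (i : ℕ))
        (Matrix.of fun i j : Fin n => ((shiftSum - 5) ^ (i : ℕ)) (risingBinom (2 * j + 1))),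
      Finset.prod_pow_eq_pow_sum, Fin.sum_univ_eq_sum_range (fun i => i), Finset.sum_range_id,
      ← Nat.choose_two_right]
    simp only [map_pow, h5]
  have hdeg : M.det.natDegree ≤ ∑ j : Fin n, (2 * (j : ℕ) + 1) :=
    natDegree_det_le_sum fun i j => (hent i j).1
  have hcoeff := coeff_det_sum (M := M) fun i j => (hent i j).1
  rw [Fin.sum_univ_eq_sum_range (fun i => 2 * i + 1), sum_range_odd, hdet] at hdeg hcoeff
  constructor
  · by_cases h0 : shiftSumDet n = 0
    · simp [h0]
    · rw [natDegree_X_pow_mul _ h0] at hdeg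
      omega
  · rw [add_comm, coeff_X_pow_mul] at hcoeff
    rw [hcoeff]
    have : (Matrix.of fun i j : Fin n => (M i j).coeff (2 * j + 1)) =
        Matrix.of fun i j : Fin n => (3 : ℚ) ^ (i : ℕ) * (Matrix.of fun i j : Fin n =>
          ((2 * (j : ℕ) + 1).factorial : ℚ)⁻¹ *
          (Matrix.of fun i j : Fin n => ((2 * (j : ℕ) + 1).descFactorial i : ℚ)) i j) i j := by
      ext i j
      simp only [Matrix.of_apply, hM, (hent i j).2, coeff_risingBinom_self]
      ring
    rw [this, Matrix.det_mul_column, Matrix.det_mul_row, det_descFactorial_odd,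
      Finset.prod_pow_eq_pow_sum, Fin.sum_univ_eq_sum_range (fun i => i), Finset.sum_range_id,
      ← Nat.choose_two_right, Fin.prod_univ_eq_prod_range (fun i => ((2 * i + 1).factorial : ℚ)⁻¹),
      show (6 : ℚ) = 2 * 3 by norm_num, mul_pow, Finset.prod_div_distrib, Finset.prod_inv_distrib]
    ring

theorem X_add_C_pow_dvd_shiftSumDet (n r : ℕ) :
    (X + C (r : ℚ)) ^ (Finset.univ.filter fun d : Fin n => ∃ i ≤ (d : ℕ), d + 2 * i + 1 = r).card ∣
      shiftSumDet n := by
  classical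
  -- With `r` fixed, all rows `d` that can vanish at `-r` are made to do so at once; the others keep
  -- `X ^ d`.
  have key (d : Fin n) : ∃ q : ℚ[X], q.Monic ∧ q.natDegree = d ∧
      ((∃ i ≤ (d : ℕ), d + 2 * i + 1 = r) →
        ∀ j : ℕ, X + C (r : ℚ) ∣ aeval shiftSum q (risingBinom (2 * j + 1))) := by
    by_cases h : ∃ i ≤ (d : ℕ), d + 2 * i + 1 = r
    · obtain ⟨i, hi, hr⟩ := h
      refine ⟨(X - C 2) ^ (d - i : ℕ) * (X - C 4) ^ i,
        ((monic_X_sub_C 2).pow _).mul ((monic_X_sub_C 4).pow _), ?_, fun _ j => ?_⟩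
      · rw [((monic_X_sub_C (2 : ℚ)).pow _).natDegree_mul ((monic_X_sub_C 4).pow _),
          natDegree_pow, natDegree_pow, natDegree_X_sub_C, natDegree_X_sub_C]
        omega
      · have := X_add_C_dvd_aeval_shiftSum i (d - i) j
        rwa [show 3 * i + (d - i) + 1 = r by omega, ← map_ofNat C 2, ← map_ofNat C 4] at this
    · exact ⟨X ^ (d : ℕ), monic_X_pow _, natDegree_X_pow _, fun h' => absurd h' h⟩
  choose q hm hq hdvd using key
  have hfac (d j : Fin n) : ∃ g : ℚ[X], aeval shiftSum (q d) (risingBinom (2 * j + 1)) =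
      (if ∃ i ≤ (d : ℕ), d + 2 * i + 1 = r then X + C (r : ℚ) else 1) * g := by
    split_ifs with h
    · exact hdvd d h j
    · exact ⟨_, (one_mul _).symm⟩
  choose g hg using hfac
  rw [← det_aeval_shiftSum_of_monic hm hq]
  simp only [hg]
  refine Dvd.dvd.trans ?_ (Matrix.det_mul_column _ (Matrix.of g)).symm.dvd
  rw [Finset.prod_ite, Finset.prod_const, Finset.prod_const_one,
    mul_one]
  exact dvd_mul_right _ _

theorem prod_X_add_C_dvd_shiftSumDet (n : ℕ) :
    ∏ d ∈ Finset.range n, ∏ i ∈ Finset.range (d + 1), (X + C ((d + 2 * i + 1 : ℕ) : ℚ)) ∣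
      shiftSumDet n := by
  classical
  have hfib (d r : ℕ) :
      ∏ i ∈ (Finset.range (d + 1)).filter (fun i => d + 2 * i + 1 = r),
        (X + C ((d + 2 * i + 1 : ℕ) : ℚ)) =
      if ∃ i ≤ d, d + 2 * i + 1 = r then X + C (r : ℚ) else 1 := by
    split_ifs with h
    · obtain ⟨i, hi, rfl⟩ := h
      rw [Finset.prod_eq_single i]
      · intro m hm hmi
        simp only [Finset.mem_filter] at hm
        omega
      · intro h'
        exact (h' (Finset.mem_filter.2 ⟨Finset.mem_range.2 (Nat.lt_succ_of_le hi), rfl⟩)).elim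
    · refine Finset.prod_eq_one fun i hi => ?_
      simp only [Finset.mem_filter, Finset.mem_range] at hi
      exact absurd ⟨i, by omega, hi.2⟩ h
  -- Grouping by the root makes the factors coprime powers; `d + 2i + 1 < 3n` bounds `r`.
  have hrw : ∏ d ∈ Finset.range n, ∏ i ∈ Finset.range (d + 1), (X + C ((d + 2 * i + 1 : ℕ) : ℚ)) =
      ∏ r ∈ Finset.range (3 * n), (X + C (r : ℚ)) ^
        (Finset.univ.filter fun d : Fin n => ∃ i ≤ (d : ℕ), d + 2 * i + 1 = r).card := by
    have h1 (d : ℕ) (hd : d ∈ Finset.range n) :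
        ∏ i ∈ Finset.range (d + 1), (X + C ((d + 2 * i + 1 : ℕ) : ℚ)) =
        ∏ r ∈ Finset.range (3 * n), if ∃ i ≤ d, d + 2 * i + 1 = r then X + C (r : ℚ) else 1 := by
      rw [← Finset.prod_fiberwise_of_maps_to (t := Finset.range (3 * n))
        (g := fun i => d + 2 * i + 1)]
      · exact Finset.prod_congr rfl fun r _ => hfib d r
      · intro i hi
        simp only [Finset.mem_range] at *
        omega
    rw [Finset.prod_congr rfl h1, Finset.prod_comm]
    refine Finset.prod_congr rfl fun r _ => ?_
    rw [← Fin.prod_univ_eq_prod_range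
      (fun d => if ∃ i ≤ d, d + 2 * i + 1 = r then X + C (r : ℚ) else 1), Finset.prod_ite,
      Finset.prod_const, Finset.prod_const_one, mul_one]
  rw [hrw]
  refine Finset.prod_dvd_of_coprime ?_ fun r _ => X_add_C_pow_dvd_shiftSumDet n r
  intro r _ s _ hrs
  refine IsCoprime.pow ?_
  have h := isCoprime_X_sub_C_of_isUnit_sub (R := ℚ) (a := -(r : ℚ)) (b := -(s : ℚ))
    (isUnit_iff_ne_zero.2 (by
      rw [Ne, sub_eq_zero, neg_inj, Nat.cast_inj]
      exact hrs))
  simpa using h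

theorem shiftSumDet_eq (n : ℕ) :
    shiftSumDet n =
      C (6 ^ n.choose 2 *
        ∏ i ∈ Finset.range n, (i.factorial : ℚ) / ((2 * i + 1).factorial : ℚ)) *
      ∏ d ∈ Finset.range n, ∏ i ∈ Finset.range (d + 1), (X + C ((d + 2 * i + 1 : ℕ) : ℚ)) := by
  have hmon (d : ℕ) : (∏ i ∈ Finset.range (d + 1), (X + C ((d + 2 * i + 1 : ℕ) : ℚ))).Monic :=
    monic_prod_of_monic _ _ fun i _ => monic_X_add_C _
  have hmonic : (∏ d ∈ Finset.range n, ∏ i ∈ Finset.range (d + 1),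
      (X + C ((d + 2 * i + 1 : ℕ) : ℚ))).Monic := monic_prod_of_monic _ _ fun d _ => hmon d
  have hdeg : (∏ d ∈ Finset.range n, ∏ i ∈ Finset.range (d + 1),
      (X + C ((d + 2 * i + 1 : ℕ) : ℚ))).natDegree = (n + 1).choose 2 := by
    rw [natDegree_prod_of_monic _ _ fun d _ => hmon d, Nat.choose_two_right,
      ← Finset.sum_range_id_mul_two (n + 1), Nat.mul_div_cancel _ two_pos, Finset.sum_range_succ']
    rw [add_zero]
    refine Finset.sum_congr rfl fun d _ => ?_
    rw [natDegree_prod_of_monic _ _ fun i _ => monic_X_add_C _]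
    simp only [natDegree_X_add_C, Finset.sum_const, Finset.card_range, smul_eq_mul, mul_one]
  obtain ⟨hle, hcoeff⟩ := shiftSumDet_degree n
  have h := eq_leadingCoeff_mul_of_monic_of_dvd_of_natDegree_le hmonic
    (prod_X_add_C_dvd_shiftSumDet n) (hle.trans hdeg.ge)
  have hlead := congrArg (fun p => coeff p ((n + 1).choose 2)) h
  simp only [coeff_C_mul] at hlead
  rw [← hdeg, coeff_natDegree, hmonic.leadingCoeff, hdeg, mul_one, hcoeff] at hlead
  rw [h, ← hlead]

end ShiftDeterminant

/-! ### Dickson polynomials and the binomial matrix -/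

section BinomMatrixDet

open Polynomial

/-- This is `D_i(u + v) = u^i + v^i` for `uv = 4`, with `u = 4T` and `v = T⁻¹`. -/
theorem aeval_shiftSum_dickson (i : ℕ) (f : ℚ[X]) :
    aeval shiftSum (dickson 1 (4 : ℚ) i) f =
      C (4 ^ i) * taylor (i : ℚ) f + taylor (-(i : ℚ)) f := by
  have hS (g : ℚ[X]) : shiftSum g = C 4 * taylor 1 g + taylor (-1) g := by
    simp [shiftSum, Module.End.ofNat_apply, nsmul_eq_mul, map_ofNat C]
  induction i using Nat.twoStepInduction with
  | zero =>
    rw [dickson_zero]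
    simp [Module.End.ofNat_apply, nsmul_eq_mul, LinearMap.sub_apply, map_ofNat (aeval shiftSum)]
    ring
  | one => simp [dickson_one, hS]
  | more i h1 h2 =>
    rw [dickson_add_two, map_sub, map_mul, map_mul, aeval_X, aeval_C, LinearMap.sub_apply,
      Module.End.mul_apply, Module.End.mul_apply, h1, h2, hS, Module.algebraMap_end_apply]
    simp only [map_add, taylor_mul, taylor_C, taylor_taylor, smul_eq_C_mul]
    rw [show (1 : ℚ) + ((i + 1 : ℕ) : ℚ) = ((i + 2 : ℕ) : ℚ) by push_cast; ring,
      show (1 : ℚ) + -((i + 1 : ℕ) : ℚ) = -(i : ℚ) by push_cast; ring,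
      show (-1 : ℚ) + ((i + 1 : ℕ) : ℚ) = (i : ℚ) by push_cast; ring,
      show (-1 : ℚ) + -((i + 1 : ℕ) : ℚ) = -((i + 2 : ℕ) : ℚ) by push_cast; ring]
    simp only [C_pow]
    ring

theorem dickson_one_four_degree (i : ℕ) :
    (dickson 1 (4 : ℚ) i).natDegree ≤ i ∧
      (dickson 1 (4 : ℚ) i).coeff i = if i = 0 then 2 else 1 := by
  induction i using Nat.twoStepInduction with
  | zero =>
    rw [dickson_zero, show (3 - ((1 : ℕ) : ℚ[X])) = C 2 by
      rw [map_ofNat]; push_cast; ring]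
    simp
  | one => simp [dickson_one]
  | more i h1 h2 =>
    have hd : (C 4 * dickson 1 (4 : ℚ) i).natDegree ≤ i := (natDegree_C_mul_le _ _).trans h1.1
    rw [dickson_add_two]
    refine ⟨(natDegree_sub_le_of_le (natDegree_mul_le_of_le natDegree_X_le h2.1) hd).trans
      (max_le (by omega) (by omega)), ?_⟩
    rw [coeff_sub, coeff_X_mul, h2.2, coeff_eq_zero_of_natDegree_lt (by omega)]
    simp

theorem binomMatrix_X_apply (n : ℕ) (i j : Fin n) :
    binomMatrix n (X : ℚ[X]) i j =
      aeval shiftSum (dickson 1 (4 : ℚ) i) (risingBinom (2 * j + 1)) := by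
  rw [aeval_shiftSum_dickson, risingBinom, taylor_choose, taylor_choose, binomMatrix,
    Matrix.of_apply]
  simp only [map_add, taylor_X, taylor_natCast, C_neg, map_natCast, C_pow, map_ofNat]
  rw [show (X : ℚ[X]) + ((i : ℕ) : ℚ[X]) + ((2 * (j : ℕ) + 1 : ℕ) : ℚ[X]) =
      X + ((i : ℕ) : ℚ[X]) + 2 * ((j : ℕ) : ℚ[X]) + 1 by push_cast; ring,
    show (X : ℚ[X]) + -((i : ℕ) : ℚ[X]) + ((2 * (j : ℕ) + 1 : ℕ) : ℚ[X]) =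
      X - ((i : ℕ) : ℚ[X]) + 2 * ((j : ℕ) : ℚ[X]) + 1 by push_cast; ring]

theorem det_binomMatrix_X {n : ℕ} (hn : 1 ≤ n) :
    (binomMatrix n (X : ℚ[X])).det =
      C (2 * (6 ^ n.choose 2 *
        ∏ i ∈ Finset.range n, (i.factorial : ℚ) / ((2 * i + 1).factorial : ℚ))) *
      ∏ d ∈ Finset.range n, ∏ i ∈ Finset.range (d + 1), (X + C ((d + 2 * i + 1 : ℕ) : ℚ)) := by
  have h : binomMatrix n (X : ℚ[X]) = Matrix.of fun i j : Fin n =>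
      aeval shiftSum (dickson 1 (4 : ℚ) i) (risingBinom (2 * j + 1)) := by
    ext1 i j
    rw [binomMatrix_X_apply, Matrix.of_apply]
  have hlead : ∏ i : Fin n, (dickson 1 (4 : ℚ) i).coeff i = 2 := by
    simp only [(dickson_one_four_degree _).2]
    rw [Fin.prod_univ_eq_prod_range (fun i => if i = 0 then (2 : ℚ) else 1),
      Finset.prod_ite_eq' (Finset.range n) 0 fun _ => (2 : ℚ), if_pos (Finset.mem_range.2 hn)]
  rw [h, det_aeval_apply shiftSum _ (fun j : Fin n => risingBinom (2 * j + 1))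
    fun i => (dickson_one_four_degree i).1, hlead, C_mul, mul_assoc, ← shiftSumDet_eq, shiftSumDet]

/-! ### Product forms and constants -/

theorem pochhammer_succ {R : Type*} [CommRing R] (a : R) (p : ℕ) :
    pochhammer a (p + 1) = pochhammer a p * (a + p) := by
  rw [pochhammer, ascPochhammer_succ_eval, pochhammer]

/-- The factor `x + 3i + 1 + k` on the left corresponds to `d = i + k` on the right. -/
theorem prod_pochhammer {R : Type*} [CommRing R] (n : ℕ) (x : R) :
    ∏ i ∈ Finset.range n, pochhammer (x + 3 * (i : R) + 1) (n - i) =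
      ∏ d ∈ Finset.range n, ∏ i ∈ Finset.range (d + 1), (x + ((d + 2 * i + 1 : ℕ) : R)) := by
  induction n with
  | zero => simp
  | succ n ih =>
    have hstep : ∀ i ∈ Finset.range (n + 1), pochhammer (x + 3 * (i : R) + 1) (n + 1 - i) =
        pochhammer (x + 3 * (i : R) + 1) (n - i) * (x + ((n + 2 * i + 1 : ℕ) : R)) := by
      intro i hi
      have hi' : i ≤ n := Nat.lt_succ_iff.1 (Finset.mem_range.1 hi)
      rw [Nat.succ_sub hi', pochhammer_succ, Nat.cast_sub hi']
      push_cast; ring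
    rw [Finset.prod_congr rfl hstep, Finset.prod_mul_distrib, Finset.prod_range_succ (n := n),
      Finset.prod_range_succ (fun d => ∏ i ∈ Finset.range (d + 1), _), ih]
    simp [pochhammer]

theorem prod_Icc_one_eq_prod_range {M : Type*} [CommMonoid M] (n : ℕ) (f : ℕ → M) :
    ∏ i ∈ Finset.Icc 1 n, f i = ∏ i ∈ Finset.range n, f (i + 1) := by
  induction n with
  | zero => simp
  | succ n ih => rw [Finset.prod_Icc_succ_top (by omega), ih, Finset.prod_range_succ]

theorem two_pow_mul_three_pow_mul_prod {K : Type*} [Field K] [CharZero K] (n : ℕ) :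
    (2 : K) ^ ((n + 1).choose 2 + 1) * 3 ^ n.choose 2 *
        ∏ i ∈ Finset.Icc 1 n, (i.factorial : K) / ((2 * i).factorial : K) =
      2 * (6 ^ n.choose 2 *
        ∏ i ∈ Finset.range n, (i.factorial : K) / ((2 * i + 1).factorial : K)) := by
  have hterm (i : ℕ) : ((i + 1).factorial : K) / ((2 * (i + 1)).factorial : K) =
      2⁻¹ * ((i.factorial : K) / ((2 * i + 1).factorial : K)) := by
    have h1 : ((i : K) + 1) ≠ 0 := Nat.cast_add_one_ne_zero i
    have h2 : ((2 * i + 1).factorial : K) ≠ 0 := Nat.cast_ne_zero.2 (Nat.factorial_ne_zero _)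
    rw [show 2 * (i + 1) = 2 * i + 1 + 1 by ring, Nat.factorial_succ, Nat.factorial_succ (2 * i + 1),
      show 2 * i + 1 + 1 = 2 * (i + 1) by ring]
    push_cast
    field_simp
  rw [prod_Icc_one_eq_prod_range, Finset.prod_congr rfl fun i _ => hterm i,
    Finset.prod_mul_distrib, Finset.prod_const, Finset.card_range, Nat.choose_succ_succ' n 1,
    Nat.choose_one_right, show (6 : K) = 2 * 3 by norm_num, mul_pow, inv_pow]
  have h2 : (2 : K) ^ n ≠ 0 := pow_ne_zero _ two_ne_zero
  field_simp
  ring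

theorem binomMatrix_map_aeval (n : ℕ) (x : ℂ) :
    (aeval x : ℚ[X] →ₐ[ℚ] ℂ).toRingHom.mapMatrix (binomMatrix n X) = binomMatrix n x := by
  ext i j
  simp [binomMatrix, Ring.map_choose, map_ofNat (aeval x)]

theorem det_binomMatrix_complex {n : ℕ} (hn : 1 ≤ n) (x : ℂ) :
    (binomMatrix n x).det =
      2 * (6 ^ n.choose 2 *
        ∏ i ∈ Finset.range n, (i.factorial : ℂ) / ((2 * i + 1).factorial : ℂ)) *
      ∏ d ∈ Finset.range n, ∏ i ∈ Finset.range (d + 1), (x + ((d + 2 * i + 1 : ℕ) : ℂ)) := by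
  rw [← binomMatrix_map_aeval, ← RingHom.map_det, det_binomMatrix_X hn]
  simp [map_prod]

/-! ### Gamma quotients -/

/-- With the convention `1 / Γ (-m) = 0`, the quotient `Γ (z + p) / Γ z` is `(z)_p` as soon as
`Γ` has no pole at `z + p`. -/
theorem Gamma_add_nat_div_Gamma {z : ℂ} {p : ℕ} (h : ∀ m : ℕ, z + p ≠ -(m : ℂ)) :
    Complex.Gamma (z + p) / Complex.Gamma z = ∏ k ∈ Finset.range p, (z + k) := by
  by_cases hz : ∃ m : ℕ, z = -(m : ℂ)
  · obtain ⟨m, rfl⟩ := hz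
    -- Otherwise `z + p` would be a pole too; hence the product contains the zero factor `z + m`,
    -- matching the division by `Γ z = 0`.
    have hmp : m < p := by
      by_contra! hpm
      apply h (m - p)
      rw [Nat.cast_sub hpm]
      ring
    rw [Complex.Gamma_neg_nat_eq_zero, div_zero, Finset.prod_eq_zero (Finset.mem_range.2 hmp)]
    ring
  · push Not at hz
    have hmul (q : ℕ) :
        Complex.Gamma (z + q) = (∏ k ∈ Finset.range q, (z + k)) * Complex.Gamma z := by
      induction q with
      | zero => simp
      | succ q ih =>
        rw [Nat.cast_succ, ← add_assoc, Complex.Gamma_add_one _ fun h0 =>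
          hz q (eq_neg_of_add_eq_zero_left h0), ih, Finset.prod_range_succ]
        ring
    rw [hmul, mul_div_cancel_right₀ _ (Complex.Gamma_ne_zero hz)]

theorem prod_Gamma_quotient {n : ℕ} {x : ℂ}
    (h : ∀ i ∈ Finset.Icc 1 n, ∀ m : ℕ, (3 * (i : ℂ) + x) / 2 ≠ -(m : ℂ)) :
    ∏ i ∈ Finset.Icc 1 n,
        ((2 : ℂ) ^ (2 * i - 1) * 3 ^ (i - 1) * Complex.Gamma (i : ℂ) *
            Complex.Gamma ((3 * (i : ℂ) + x) / 2)) /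
          (Complex.Gamma (2 * (i : ℂ)) * Complex.Gamma (((i : ℂ) + x) / 2)) =
      6 ^ n.choose 2 *
        (∏ i ∈ Finset.range n, (i.factorial : ℂ) / ((2 * i + 1).factorial : ℂ)) *
      ∏ d ∈ Finset.range n, ∏ i ∈ Finset.range (d + 1), (x + ((d + 2 * i + 1 : ℕ) : ℂ)) := by
  have hterm : ∀ d ∈ Finset.range n,
      ((2 : ℂ) ^ (2 * (d + 1) - 1) * 3 ^ (d + 1 - 1) * Complex.Gamma ((d + 1 : ℕ) : ℂ) *
            Complex.Gamma ((3 * ((d + 1 : ℕ) : ℂ) + x) / 2)) /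
          (Complex.Gamma (2 * ((d + 1 : ℕ) : ℂ)) * Complex.Gamma ((((d + 1 : ℕ) : ℂ) + x) / 2)) =
        6 ^ d * ((d.factorial : ℂ) / ((2 * d + 1).factorial : ℂ)) *
          ∏ i ∈ Finset.range (d + 1), (x + ((d + 2 * i + 1 : ℕ) : ℂ)) := by
    intro d hd
    have hd' : d + 1 ∈ Finset.Icc 1 n := by simp only [Finset.mem_range, Finset.mem_Icc] at *; omega
    -- The two Gamma arguments differ by the integer `d + 1`, so their quotient is a finite product.
    have hz : (3 * ((d + 1 : ℕ) : ℂ) + x) / 2 = (((d + 1 : ℕ) : ℂ) + x) / 2 + ((d + 1 : ℕ) : ℂ) := by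
      ring
    have hq := h _ hd'
    rw [hz] at hq
    have hprod : ∏ k ∈ Finset.range (d + 1), ((((d + 1 : ℕ) : ℂ) + x) / 2 + k) =
        (2 ^ (d + 1))⁻¹ * ∏ i ∈ Finset.range (d + 1), (x + ((d + 2 * i + 1 : ℕ) : ℂ)) := by
      rw [← inv_pow, ← Finset.card_range (d + 1), ← Finset.prod_const, Finset.card_range,
        ← Finset.prod_mul_distrib]
      refine Finset.prod_congr rfl fun k _ => ?_
      push_cast; ring
    rw [mul_div_mul_comm, hz, Gamma_add_nat_div_Gamma hq, hprod,
      show 2 * ((d + 1 : ℕ) : ℂ) = ((2 * d + 1 : ℕ) : ℂ) + 1 by push_cast; ring, Nat.cast_succ d,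
      Complex.Gamma_nat_eq_factorial, Complex.Gamma_nat_eq_factorial, Nat.add_sub_cancel,
      show 2 * (d + 1) - 1 = d + (d + 1) by omega, pow_add 2 d, show (6 : ℂ) = 2 * 3 by norm_num,
      mul_pow]
    have h2 : (2 : ℂ) ^ (d + 1) ≠ 0 := pow_ne_zero _ two_ne_zero
    field_simp
  rw [prod_Icc_one_eq_prod_range, Finset.prod_congr rfl hterm, Finset.prod_mul_distrib,
    Finset.prod_mul_distrib, Finset.prod_pow_eq_pow_sum, Finset.sum_range_id,
    ← Nat.choose_two_right]

end BinomMatrixDet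

/-- First the identity of polynomials in the indeterminate `X`; then the chain of equalities with
the Gamma function, at every complex `x` where no Gamma factor in the numerator has a pole.
The value `0` of `Complex.Gamma` at its poles, together with `a / 0 = 0`, makes a factor whose
denominator alone has a pole equal to `0`, which is the usual convention `1 / Γ (-m) = 0`. -/
theorem theorem7p2 (n : ℕ) (hn : 1 ≤ n) :
    (binomMatrix n (Polynomial.X : Polynomial ℚ)).det =
      Polynomial.C ((2 : ℚ) ^ ((n + 1).choose 2 + 1) * 3 ^ (n.choose 2) *
          ∏ i ∈ Finset.Icc 1 n, (i.factorial : ℚ) / ((2 * i).factorial : ℚ)) *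
        ∏ i ∈ Finset.range n,
          pochhammer (Polynomial.X + 3 * (i : Polynomial ℚ) + 1) (n - i) ∧
    ∀ x : ℂ, (∀ i ∈ Finset.Icc 1 n, ∀ m : ℕ, (3 * (i : ℂ) + x) / 2 ≠ -(m : ℂ)) →
      (binomMatrix n x).det =
          2 * ∏ i ∈ Finset.Icc 1 n,
            ((2 : ℂ) ^ (2 * i - 1) * 3 ^ (i - 1) * Complex.Gamma (i : ℂ) *
                Complex.Gamma ((3 * (i : ℂ) + x) / 2)) /
              (Complex.Gamma (2 * (i : ℂ)) * Complex.Gamma (((i : ℂ) + x) / 2)) ∧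
      2 * ∏ i ∈ Finset.Icc 1 n,
            ((2 : ℂ) ^ (2 * i - 1) * 3 ^ (i - 1) * Complex.Gamma (i : ℂ) *
                Complex.Gamma ((3 * (i : ℂ) + x) / 2)) /
              (Complex.Gamma (2 * (i : ℂ)) * Complex.Gamma (((i : ℂ) + x) / 2)) =
          (2 : ℂ) ^ ((n + 1).choose 2 + 1) * 3 ^ (n.choose 2) *
            (∏ i ∈ Finset.Icc 1 n, (i.factorial : ℂ) / ((2 * i).factorial : ℂ)) *
            ∏ i ∈ Finset.range n, pochhammer (x + 3 * (i : ℂ) + 1) (n - i) := by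
  refine ⟨?_, fun x hx => ⟨?_, ?_⟩⟩
  · rw [det_binomMatrix_X hn, two_pow_mul_three_pow_mul_prod, prod_pochhammer]
    simp only [map_natCast]
  · rw [det_binomMatrix_complex hn, prod_Gamma_quotient hx, mul_assoc]
  · rw [prod_Gamma_quotient hx, two_pow_mul_three_pow_mul_prod, prod_pochhammer]
    ring
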